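/- Let $n,k_0,k_1$ be natural numbers with $n\ge k_0+k_1\ge 3$, $\bar k=(k_0,k_1)$, and let $\eta:\{0,\dots,n-1\}\to\{0,1\}$ be such that $|\eta^{-1}\{\iota\}|\ge k_\iota\ge 1$ for $\iota=0,1$. Assume moreover that for some $\iota\in\{0,1\}$ we have $k_\iota\ge 2$ and $\eta^{-1}\{\iota\}$ is not convex, i.e. there are $a<b<c<n$ with $\eta(a)=\eta(c)=\iota\ne\eta(b)$ (for example: $k_0\ge2$, $\eta(0)=0$ and $\eta^{-1}\{0\}$ is not an initial segment of $\{0,\dots,n-1\}$). Let $\tau=\{P,Q_0,Q_1\}$ with $P$ a binary and $Q_\iota$ a $(k_\iota+1)$-place predicate. Let $N^*$ be the $\tau$-structure with universe $\{a_0,\dots,a_n\}$ (distinct elements) in which $P(a_i,a_j)$ holds iff $i<j$, and $Q_\iota$ holds exactly of the tuples $(a_{\ell_0},\dots,a_{\ell_{k_\iota-1}},a_\ell)$ with $\ell_0<\dots<\ell_{k_\iota-1}<\ell\le n$ and $\ell_0,\dots,\ell_{k_\iota-1}\in\eta^{-1}\{\iota\}$. Then there is a complete countable first order theory $T$ in the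 vocabulary $\tau$ such that: 1. $T$ is categorical in $\aleph_0$. 2. $T$ is $\mathrm{NSOP}_4$: there is no formula $\varphi(\bar x,\bar y)$ (with $\bar x,\bar y$ of the same finite length) such that in some model of $T$ there are $\bar a_i$ $(i<\omega)$ with $\varphi[\bar a_i,\bar a_j]$ for all $i<j$, but there are no $\bar x_0,\dots,\bar x_3$ with $\varphi(\bar x_0,\bar x_1)\wedge\varphi(\bar x_1,\bar x_2)\wedge\varphi(\bar x_2,\bar x_3)\wedge\varphi(\bar x_3,\bar x_0)$. 3. $T$ has the $(\eta,\bar k,1)$-olive property, where the $(\eta,\bar k,m)$-olive property says that there are first order formulas $\psi_{\iota,k}(\bar x_0,\dots,\bar x_k)$, for $\iota\in\{0,1\}$ and $1\le k\le k_\iota$, with each $\bar x_i$ an $m$-tuple of variables, such that (b) for every ordinal $\lambda$ there is a model of $T$ in which, for all functions $f_\beta:\beta\to\{0,1\}$ $(\beta<\lambda)$, there are $m$-tuples $\bar a_\alpha$ $(\alpha<\lambda)$ such that $\psi_{\iota,k}[\bar a_{\alpha_0},\dots,\bar a_{\alpha_{k-1}},\bar a_\beta]$ holds whenever $\iota\in\{0,1\}$,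 $1\le k\le k_\iota$, $\alpha_0<\dots<\alpha_{k-1}<\beta<\lambda$ and $f_\beta$ is constantly $\iota$ on $[\alpha_0,\alpha_{k-1}]$; (c) in no model of $T$ are there $m$-tuples $\bar a_0,\dots,\bar a_n$ such that $\psi_{\iota,k}[\bar a_{\ell_0},\dots,\bar a_{\ell_{k-1}},\bar a_\ell]$ holds whenever $\iota\in\{0,1\}$, $1\le k\le k_\iota$, $\ell_0<\dots<\ell_{k-1}<\ell\le n$ and $\ell_0,\dots,\ell_{k-1}\in\eta^{-1}\{\iota\}$. 4. $T$ is the model completion of a universal theory $T^0$ whose models are exactly the (nonempty) $\tau$-structures $M$ omitting $N^*$, i.e. such that there is no injective homomorphism from $N^*$ into $M$. (Model completion: every model of $T$ is a model of $T^0$, every model of $T^0$ embeds into a model of $T$, and for every model $A$ of $T^0$ any two models of $T$ extending $A$ satisfy the same formulas with parameters from $A$.) -/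

import Mathlib

open FirstOrder

namespace Olive

open FirstOrder.Language

section ModelTheory

variable {L : FirstOrder.Language.{0, 0}}

/-- The strong order property `SOP_N`: some formula `φ(x̄, ȳ)` orders an infinite sequence
of `m`-tuples in some model of `T`, while `φ` has no cycle of length `N` in that model. -/
def HasSOP (T : L.Theory) (N : ℕ) : Prop :=
  ∃ (m : ℕ) (φ : L.Formula (Fin m ⊕ Fin m)) (M : FirstOrder.Language.Theory.ModelType.{0, 0, 0} T),
    (∃ a : ℕ → Fin m → M, ∀ i j : ℕ, i < j → φ.Realize (Sum.elim (a i) (a j))) ∧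
    ¬ ∃ x : Fin N → Fin m → M, ∀ i : Fin N, φ.Realize (Sum.elim (x i) (x (finRotate N i)))

/-- `φ[ā₀, …, ā_{k-1}, b̄]`, for a formula in `k + 1` blocks of `m` variables. -/
def RealizeBlocks {M : Type} [L.Structure M] {m k : ℕ} (φ : L.Formula (Fin (k + 1) × Fin m))
    (a : Fin k → Fin m → M) (b : Fin m → M) : Prop :=
  φ.Realize fun p => (Fin.snoc (α := fun _ => Fin m → M) a b : Fin (k + 1) → Fin m → M) p.1 p.2

/-- Clause (b) for an ordinal `lam` in a model `M`: for all functions `f_β : β → {0, 1}`,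
`β < lam`, there are `m`-tuples `ā_α`, `α < lam`, such that `ψ_{ι,k}[ā_{α_0}, …, ā_{α_{k-1}}, ā_β]`
holds whenever `1 ≤ k ≤ k_ι`, `α_0 < ⋯ < α_{k-1} < β < lam` and `f_β` is constantly `ι` on
`[α_0, α_{k-1}]`. For `k = 1` this says `φ_ι[ā_α, ā_β]` for `α < β` and `ι = f_β(α)`, where
`φ_ι = ψ_{ι,1}`. Only the values `f β α` with `α < β < lam` and `a α` with `α < lam` matter. -/
def RealizesAll (M : Type) [L.Structure M] {m : ℕ} (k : Fin 2 → ℕ)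
    (ψ : Fin 2 → (j : ℕ) → L.Formula (Fin (j + 1) × Fin m)) (lam : Ordinal.{0}) : Prop :=
  ∀ f : Ordinal.{0} → Ordinal.{0} → Fin 2, ∃ a : Ordinal.{0} → Fin m → M,
    ∀ (ι : Fin 2) (j : ℕ), 1 ≤ j → j ≤ k ι →
      ∀ (s : Fin j → Ordinal.{0}) (β : Ordinal.{0}), StrictMono s → (∀ i, s i < β) → β < lam →
        (∀ (i i' : Fin j) (γ : Ordinal.{0}), s i ≤ γ → γ ≤ s i' → f β γ = ι) →
          RealizeBlocks (ψ ι j) (fun i => a (s i)) (a β)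

/-- The configuration of clause (c) occurs in `M`: there are `m`-tuples `ā_0, …, ā_n` such that
`ψ_{ι,k}[ā_{ℓ_0}, …, ā_{ℓ_{k-1}}, ā_ℓ]` holds whenever `1 ≤ k ≤ k_ι`,
`ℓ_0 < ⋯ < ℓ_{k-1}` are in `η⁻¹{ι}` and `ℓ_{k-1} < ℓ ≤ n`.
For `k = 1` this says `φ_ι[ā_i, ā_ℓ]` for `i < ℓ ≤ n` and `ι = η(i)`. -/
def RealizesConfig (M : Type) [L.Structure M] {n m : ℕ} (η : Fin n → Fin 2) (k : Fin 2 → ℕ)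
    (ψ : Fin 2 → (j : ℕ) → L.Formula (Fin (j + 1) × Fin m)) : Prop :=
  ∃ a : Fin (n + 1) → Fin m → M,
    ∀ (ι : Fin 2) (j : ℕ), 1 ≤ j → j ≤ k ι →
      ∀ (s : Fin j → Fin n) (e : Fin (n + 1)), StrictMono s → (∀ i, η (s i) = ι) →
        (∀ i, (s i).castSucc < e) →
          RealizeBlocks (ψ ι j) (fun i => a (s i).castSucc) (a e)

/-- The `(η, k̄, m)`-olive property of a complete theory `T` (formulas from the full language):
for some `ψ_{ι,k}`, clause (b) holds for every `lam` in some (large enough) model of `T`, and the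
configuration of clause (c) occurs in no model of `T`. -/
def HasOlive (T : L.Theory) {n : ℕ} (η : Fin n → Fin 2) (k : Fin 2 → ℕ) (m : ℕ) : Prop :=
  ∃ ψ : Fin 2 → (j : ℕ) → L.Formula (Fin (j + 1) × Fin m),
    (∀ lam : Ordinal.{0}, ∃ M : FirstOrder.Language.Theory.ModelType.{0, 0, 0} T,
      RealizesAll M k ψ lam) ∧
    ∀ M : FirstOrder.Language.Theory.ModelType.{0, 0, 0} T, ¬ RealizesConfig M η k ψ

/-- `T` is the model completion of `T₀`: models of `T` are models of `T₀`, every model of `T₀`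
embeds into a model of `T`, and for every model `A` of `T₀` the theory `T ∪ Diag(A)` is complete,
that is, any two models of `T` extending `A` are elementarily equivalent over `A`. -/
structure IsModelCompletion (T T₀ : L.Theory) : Prop where
  models : ∀ M : FirstOrder.Language.Theory.ModelType.{0, 0, 0} T, (M : Type) ⊨ T₀
  embeds : ∀ A : FirstOrder.Language.Theory.ModelType.{0, 0, 0} T₀,
    ∃ M : FirstOrder.Language.Theory.ModelType.{0, 0, 0} T, Nonempty (A ↪[L] M)
  complete_diagram : ∀ (A : FirstOrder.Language.Theory.ModelType.{0, 0, 0} T₀)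
    (M N : FirstOrder.Language.Theory.ModelType.{0, 0, 0} T) (f : A ↪[L] M) (g : A ↪[L] N)
    (r : ℕ) (φ : L.Formula (Fin r)) (a : Fin r → A), φ.Realize (f ∘ a) ↔ φ.Realize (g ∘ a)

end ModelTheory

/-- A binary relation symbol `P` and, for `ι = 0, 1`, a `(k_ι + 1)`-place symbol `Q_ι`. -/
inductive OliveRel (k : Fin 2 → ℕ) : ℕ → Type
  | P : OliveRel k 2
  | Q (ι : Fin 2) : OliveRel k (k ι + 1)

/-- The vocabulary `{P, Q₀, Q₁}`. -/
def oliveLang (k : Fin 2 → ℕ) : FirstOrder.Language.{0, 0} :=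
  ⟨fun _ => Empty, OliveRel k⟩

/-- The universe `{a_0, …, a_n}` of the forbidden configuration. -/
def Forbidden (_k : Fin 2 → ℕ) {n : ℕ} (_ : Fin n → Fin 2) : Type := Fin (n + 1)

/-- In the forbidden configuration, `P(a_i, a_j)` holds exactly for `i < j`, and `Q_ι` holds
exactly of the tuples `(a_{ℓ_0}, …, a_{ℓ_{k_ι - 1}}, a_ℓ)` with `ℓ_0 < ⋯ < ℓ_{k_ι - 1}` in
`η⁻¹{ι}` and `ℓ_{k_ι - 1} < ℓ ≤ n`. -/
instance instStructureForbidden (k : Fin 2 → ℕ) {n : ℕ} (η : Fin n → Fin 2) :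
    (oliveLang k).Structure (Forbidden k η) where
  funMap := fun F _ => Empty.elim F
  RelMap := fun {_} R =>
    match R with
    | OliveRel.P => fun x : Fin 2 → Fin (n + 1) => x 0 < x 1
    | OliveRel.Q ι => fun x : Fin (k ι + 1) → Fin (n + 1) =>
        ∃ (s : Fin (k ι) → Fin n) (e : Fin (n + 1)), StrictMono s ∧ (∀ i, η (s i) = ι) ∧
          (∀ i, (s i).castSucc < e) ∧
          x = Fin.snoc (α := fun _ => Fin (n + 1)) (fun i => (s i).castSucc) e

/-- `M` omits the forbidden configuration: there is no copy of it in `M`, where, as in clause (c),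
a copy consists of distinct elements satisfying at least the relations of the configuration. -/
def OmitsForbidden (k : Fin 2 → ℕ) {n : ℕ} (η : Fin n → Fin 2) (M : Type)
    [(oliveLang k).Structure M] : Prop :=
  ¬ ∃ h : Forbidden k η →[oliveLang k] M, Function.Injective h

end Olive

/-! Call the forbidden configuration `F`. Since `P` relates any two of its points, `F` is
irreducible: a copy of it in a free amalgam lies inside one of the pieces. So structures omitting
`F` can be amalgamated freely, and each embeds in a generic one (`exists_generic`). In a finite
relational language genericity is first order (`model_genericTheory`); its axioms form `T`. By
back-and-forth, quantifier-free types in generic structures decide all formulas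
(`Generic.realize_iff`), whence completeness, the model completion and, with a countable
back-and-forth, categoricity.

For NSOP₄, Ramsey gives members `a`, `b`, `c` of the ordered sequence whose pairs `ab`, `ac`, `bc`
have one quantifier-free type. Glue four copies of `a` freely round a cycle, consecutive copies
looking like `ab`. The 4-cycle has no triangle, so a copy of `F` would lie in two consecutive
copies, hence in a structure that omits it (`cycleGlue_omits`). The glued structure thus occurs in
every model, as a cycle for the formula.

For the olive property, the formulas are chosen so that clause (c) says that `F` is omitted. Clause
(b) holds in `Colourings`, which contains every system of functions. It omits `F`: for the gap `a <
b < c`, the colouring at the top point of a copy would be constantly `ι` from `a` to `c`, yet take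
the value `η b ≠ ι` at `b` (`colourings_omits`). -/

namespace Olive

open FirstOrder.Language FirstOrder.Language.Structure

/-! ### Quantifier-free types, genericity and back-and-forth. -/

section General

variable (L : FirstOrder.Language.{0, 0}) {M N K : Type} [L.Structure M] [L.Structure N]
  [L.Structure K] {ι κ : Type}

/-- Two families of elements satisfy the same equalities and the same relations. -/
structure SameType (x : ι → M) (y : ι → N) : Prop where
  eq_iff : ∀ i j, x i = x j ↔ y i = y j
  rel_iff : ∀ {p : ℕ} (R : L.Relations p) (s : Fin p → ι), RelMap R (x ∘ s) ↔ RelMap R (y ∘ s)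

variable {L}

namespace SameType

variable {x : ι → M} {y : ι → N} {z : ι → K}

theorem symm (h : SameType L x y) : SameType L y x :=
  ⟨fun i j => (h.eq_iff i j).symm, fun R s => (h.rel_iff R s).symm⟩

theorem trans (h : SameType L x y) (h' : SameType L y z) : SameType L x z :=
  ⟨fun i j => (h.eq_iff i j).trans (h'.eq_iff i j),
    fun R s => (h.rel_iff R s).trans (h'.rel_iff R s)⟩

theorem comp (h : SameType L x y) (g : κ → ι) : SameType L (x ∘ g) (y ∘ g) :=
  ⟨fun i j => h.eq_iff (g i) (g j), fun R s => h.rel_iff R (g ∘ s)⟩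

theorem embedding (f : M ↪[L] N) (x : ι → M) : SameType L x (f ∘ x) :=
  ⟨fun _ _ => f.injective.eq_iff.symm, fun R s => (f.map_rel R (x ∘ s)).symm⟩

theorem refl (x : ι → M) : SameType L x x :=
  ⟨fun _ _ => Iff.rfl, fun _ _ => Iff.rfl⟩

theorem of_isEmpty [IsEmpty ι] [IsEmpty (L.Relations 0)] (x : ι → M) (y : ι → N) :
    SameType L x y :=
  ⟨fun i => isEmptyElim i, fun {p} R s => by
    cases p with
    | zero => exact isEmptyElim R
    | succ p => exact isEmptyElim (s 0)⟩

end SameType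

/-- `x` extended by the value `a`. -/
def adjoin (x : ι → M) (a : M) : Option ι → M := fun o => o.elim a x

variable (L) in
/-- No injective homomorphism from `F` to `M`. -/
def Omits (F M : Type) [L.Structure F] [L.Structure M] : Prop :=
  ¬ ∃ h : F →[L] M, Function.Injective h

variable (L) in
/-- `M` omits `F` and realizes every one-point extension, among structures omitting `F`, of every
finite part of `M`. -/
structure Generic (F M : Type) [L.Structure F] [L.Structure M] : Prop where
  omits : Omits L F M
  extend : ∀ (N : Type) [L.Structure N], Omits L F N → ∀ (ι : Type) [Finite ι]
    (x : ι → M) (y : ι → N), SameType L x y → ∀ b : N, ∃ a : M, SameType L (adjoin x a) (adjoin y b)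

variable {F : Type} [L.Structure F]

theorem Generic.exists_sameType [IsEmpty (L.Relations 0)] (hM : Generic L F M)
    (hN : Omits L F N) {r : ℕ} (y : Fin r → N) : ∃ x : Fin r → M, SameType L x y := by
  induction r with
  | zero => exact ⟨Fin.elim0, .of_isEmpty _ _⟩
  | succ r ih =>
    obtain ⟨x, hx⟩ := ih (y ∘ Fin.castSucc)
    obtain ⟨a, ha⟩ := hM.extend N hN _ x _ hx (y (Fin.last r))
    have h := ha.comp (Fin.lastCases none some : Fin (r + 1) → Option (Fin r))
    refine ⟨_, h.trans (z := y) ?_⟩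
    convert SameType.refl y using 1
    funext i
    induction i using Fin.lastCases <;> simp [adjoin]

theorem Generic.exists_sameType_of_finite [IsEmpty (L.Relations 0)] [Finite ι]
    (hM : Generic L F M) (hN : Omits L F N) (y : ι → N) : ∃ x : ι → M, SameType L x y := by
  obtain ⟨r, ⟨e⟩⟩ := Finite.exists_equiv_fin ι
  obtain ⟨x, hx⟩ := hM.exists_sameType hN (y ∘ e.symm)
  refine ⟨x ∘ e, ?_⟩
  have := hx.comp e
  rwa [Function.comp_assoc, e.symm_comp_self, Function.comp_id] at this

theorem exists_eq_var [L.IsRelational] {α : Type} {p : ℕ} (ts : Fin p → L.Term α) :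
    ∃ s : Fin p → α, ts = fun i => Term.var (s i) := by
  have : ∀ t : L.Term α, ∃ a, t = Term.var a
    | .var a => ⟨a, rfl⟩
    | .func f _ => isEmptyElim f
  choose g hg using this
  exact ⟨fun i => g (ts i), funext fun i => hg _⟩

theorem adjoin_comp_snoc {α : Type} {n : ℕ} (v : α → M) (xs : Fin n → M) (a : M) :
    adjoin (Sum.elim v xs) a ∘ Sum.elim (some ∘ Sum.inl) (Fin.lastCases none (some ∘ Sum.inr)) =
      Sum.elim v (Fin.snoc xs a) := by
  funext i
  rcases i with i | i
  · rfl
  · induction i using Fin.lastCases <;> simp [adjoin]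

/-- Back-and-forth: at a quantifier, genericity of one structure supplies a match for a point chosen
in the other, which is itself a structure omitting `F`. -/
theorem Generic.realize_iff [L.IsRelational] (hM : Generic L F M) (hN : Generic L F N) {α : Type}
    [Finite α] {n : ℕ} (φ : L.BoundedFormula α n) : ∀ {v : α → M} {w : α → N} {xs : Fin n → M}
    {ys : Fin n → N}, SameType L (Sum.elim v xs) (Sum.elim w ys) →
      (φ.Realize v xs ↔ φ.Realize w ys) := by
  induction φ with
  | falsum => exact fun _ => Iff.rfl
  | equal t₁ t₂ =>
    intro v w xs ys h
    obtain ⟨s, hs⟩ := exists_eq_var ![t₁, t₂]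
    obtain rfl : t₁ = _ := congr_fun hs 0
    obtain rfl : t₂ = _ := congr_fun hs 1
    exact h.eq_iff _ _
  | rel R ts =>
    intro v w xs ys h
    obtain ⟨s, rfl⟩ := exists_eq_var ts
    exact h.rel_iff R s
  | imp _ _ ih₁ ih₂ => exact fun h => imp_congr (ih₁ h) (ih₂ h)
  | all φ ih =>
    intro v w xs ys h
    constructor
    · intro H b
      obtain ⟨a, ha⟩ := hM.extend N hN.omits _ _ _ h b
      have := ha.comp (Sum.elim (some ∘ Sum.inl) (Fin.lastCases none (some ∘ Sum.inr)))
      rw [adjoin_comp_snoc, adjoin_comp_snoc] at this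
      exact (ih this).1 (H a)
    · intro H a
      obtain ⟨b, hb⟩ := hN.extend M hM.omits _ _ _ h.symm a
      have := hb.symm.comp (Sum.elim (some ∘ Sum.inl) (Fin.lastCases none (some ∘ Sum.inr)))
      rw [adjoin_comp_snoc, adjoin_comp_snoc] at this
      exact (ih this).2 (H b)

theorem Generic.formula_realize_iff [L.IsRelational] (hM : Generic L F M) (hN : Generic L F N)
    {α : Type} [Finite α] (φ : L.Formula α) {v : α → M} {w : α → N} (h : SameType L v w) :
    φ.Realize v ↔ φ.Realize w := by
  refine hM.realize_iff hN φ ?_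
  convert h.comp (Sum.elim id finZeroElim) using 1 <;>
  · funext i
    rcases i with i | i
    · rfl
    · exact i.elim0

end General

/-! ### Generic extensions by iterated free amalgamation. -/

section Existence

variable (L : FirstOrder.Language.{0, 0}) (F M : Type) [L.Structure F] [L.Structure M]

/-- A proper one-point extension of a finite tuple of `M`, given by the relations on the
extended tuple and realized in a structure omitting `F`. -/
structure ExtensionProblem where
  size : ℕ
  base : Fin size → M
  rel : ∀ {p : ℕ}, L.Relations p → (Fin p → Option (Fin size)) → Prop
  realized : ∃ (N : Type) (_ : L.Structure N) (y : Option (Fin size) → N), Omits L F N ∧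
    SameType L base (y ∘ some) ∧ (∀ i, y (some i) ≠ y none) ∧
      ∀ {p : ℕ} (R : L.Relations p) s, rel R s ↔ RelMap R (y ∘ s)

/-- The free amalgam over `M` of all its one-point extensions. -/
def OneStep : Type := M ⊕ ExtensionProblem L F M

variable {L F M}

/-- The tuple of an extension problem, together with the new point that solves it. -/
def ExtensionProblem.tuple (e : ExtensionProblem L F M) : Option (Fin e.size) → OneStep L F M :=
  adjoin (Sum.inl ∘ e.base) (Sum.inr e)

theorem OneStep.mem_tuple_inr {e e' : ExtensionProblem L F M} {o : Option (Fin e'.size)}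
    (h : e'.tuple o = Sum.inr e) : e' = e := by
  cases o with
  | none => exact Sum.inr_injective h
  | some i => exact absurd h Sum.inl_ne_inr

theorem ExtensionProblem.tuple_eq_iff (e : ExtensionProblem L F M) {N : Type} [L.Structure N]
    {y : Option (Fin e.size) → N} (hy : SameType L e.base (y ∘ some))
    (hne : ∀ i, y (some i) ≠ y none) (i j : Option (Fin e.size)) :
    e.tuple i = e.tuple j ↔ y i = y j := by
  cases i with
  | none =>
    cases j with
    | none => simp
    | some j => exact iff_of_false Sum.inr_ne_inl (hne j).symm
  | some i =>
    cases j with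
    | none => exact iff_of_false Sum.inl_ne_inr (hne i)
    | some j =>
      refine Iff.trans ?_ (hy.eq_iff i j)
      exact Sum.inl_injective.eq_iff

/-- Freeness: a relation lives in `M` or in the tuple of a single problem, so distinct new points
are never related. -/
instance [L.IsRelational] : L.Structure (OneStep L F M) where
  funMap := fun f _ => isEmptyElim f
  RelMap := fun R z => (∃ w, z = Sum.inl ∘ w ∧ RelMap R w) ∨
    ∃ (e : ExtensionProblem L F M) (s : _), z = e.tuple ∘ s ∧ e.rel R s

variable [L.IsRelational]

/-- A problem imposes nothing new on old points, because its prescribed relations agree with those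
of `M` on the base. -/
theorem OneStep.relMap_inl {p : ℕ} (R : L.Relations p) (w : Fin p → M) :
    RelMap R (M := OneStep L F M) (Sum.inl ∘ w) ↔ RelMap R w := by
  refine ⟨?_, fun h => .inl ⟨w, rfl, h⟩⟩
  rintro (⟨w', h, hw⟩ | ⟨e, s, h, hs⟩)
  · obtain rfl : w = w' := funext fun i => Sum.inl_injective (congr_fun h i)
    exact hw
  · have : ∀ i, ∃ j, s i = some j := fun i => by
      have := congr_fun h i
      cases hi : s i with
      | none =>
        have h' : e.tuple (s i) = Sum.inr e := by rw [hi]; rfl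
        exact absurd (this.trans h') Sum.inl_ne_inr
      | some j => exact ⟨j, rfl⟩
    choose t ht using this
    obtain rfl : s = some ∘ t := funext ht
    obtain rfl : w = e.base ∘ t := funext fun i => Sum.inl_injective (congr_fun h i)
    obtain ⟨N, _, y, -, hy, -, hrel⟩ := e.realized
    rw [hrel] at hs
    exact (hy.rel_iff R t).2 hs

variable (L F M) in
/-- The inclusion of `M` in the free amalgam of its one-point extensions. -/
def OneStep.inl : M ↪[L] OneStep L F M where
  toFun := Sum.inl
  inj' := Sum.inl_injective
  map_fun' f := isEmptyElim f
  map_rel' R w := OneStep.relMap_inl R w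

theorem ExtensionProblem.sameType_tuple (e : ExtensionProblem L F M) {N : Type} [L.Structure N]
    {y : Option (Fin e.size) → N} (hy : SameType L e.base (y ∘ some))
    (hne : ∀ i, y (some i) ≠ y none)
    (hrel : ∀ {p : ℕ} (R : L.Relations p) s, e.rel R s ↔ RelMap R (y ∘ s)) :
    SameType L e.tuple y := by
  refine ⟨e.tuple_eq_iff hy hne, fun {p} R s => ?_⟩
  by_cases hs : ∃ q, s q = none
  -- A related tuple through the new point can only come from the problem which that point solves.
  · obtain ⟨q, hq⟩ := hs
    have hnew : e.tuple (s q) = Sum.inr e := by rw [hq]; rfl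
    refine ⟨?_, fun h => .inr ⟨e, s, rfl, (hrel R s).2 h⟩⟩
    rintro (⟨w, h, -⟩ | ⟨e', s', h, hs'⟩)
    · have := (congr_fun h q).symm.trans hnew
      exact absurd this (by simp)
    · obtain rfl := OneStep.mem_tuple_inr ((congr_fun h q).symm.trans hnew)
      have : y ∘ s = y ∘ s' := funext fun i => (e'.tuple_eq_iff hy hne _ _).1 (congr_fun h i)
      rw [this]
      exact (hrel R s').1 hs'
  · have : ∀ q, ∃ j, s q = some j := fun q =>
      Option.ne_none_iff_exists'.1 fun h => hs ⟨q, h⟩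
    choose t ht using this
    obtain rfl : s = some ∘ t := funext ht
    exact (OneStep.relMap_inl R (e.base ∘ t)).trans (hy.rel_iff R t)

variable (L F) in
/-- Any two elements of `F` occur together in a related tuple. -/
def Irreducible : Prop :=
  ∀ i j : F, ∃ (p : ℕ) (R : L.Relations p) (w : Fin p → F),
    RelMap R w ∧ i ∈ Set.range w ∧ j ∈ Set.range w

/-- A copy of `F` inside a family could be carried to any family of the same type. Every omission
proof for an amalgam ends here. -/
theorem Omits.of_factor {N K : Type} [L.Structure N] [L.Structure K] (hN : Omits L F N)
    {κ : Type} {x : κ → K} {y : κ → N} (hxy : SameType L x y) (h : F →[L] K)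
    (hh : Function.Injective h) : ¬ ∀ i, h i ∈ Set.range x := by
  intro H
  choose s hs using H
  have hcomp : ⇑h = x ∘ s := funext fun i => (hs i).symm
  refine hN ⟨⟨y ∘ s, fun f => isEmptyElim f, fun R w hw => ?_⟩, fun i j hij => ?_⟩
  · have := h.map_rel R w hw
    rw [hcomp] at this
    exact (hxy.rel_iff R (s ∘ w)).1 this
  · refine hh ?_
    rw [hcomp]
    exact (hxy.eq_iff _ _).2 hij

/-- If a copy of `F` contains a new point, irreducibility puts all its other points in the tuple of
that problem, which is modelled on a structure omitting `F`. Otherwise the copy lies in `M`. -/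
theorem OneStep.omits (hF : Irreducible L F) (hM : Omits L F M) : Omits L F (OneStep L F M) := by
  rintro ⟨h, hh⟩
  by_cases hnew : ∃ i e, h i = Sum.inr e
  · obtain ⟨i, e, hi⟩ := hnew
    obtain ⟨N, _, y, hN, hy, hne, hrel⟩ := e.realized
    refine hN.of_factor (e.sameType_tuple hy hne hrel) h hh fun j => ?_
    obtain ⟨p, R, w, hw, ⟨a, ha⟩, ⟨b, hb⟩⟩ := hF i j
    rcases h.map_rel R w hw with ⟨w', h', -⟩ | ⟨e', s, h', -⟩
    · have := congr_fun h' a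
      simp [ha, hi] at this
    · have he := congr_fun h' a
      simp only [Function.comp_apply, ha, hi] at he
      obtain rfl := OneStep.mem_tuple_inr he.symm
      exact ⟨s b, by rw [← hb]; exact (congr_fun h' b).symm⟩
  · refine hM.of_factor (SameType.embedding (OneStep.inl L F M) id).symm h hh fun j => ?_
    cases hj : h j with
    | inl a => exact ⟨a, rfl⟩
    | inr e => exact absurd ⟨j, e, hj⟩ hnew

theorem OneStep.extend {N : Type} [L.Structure N] (hN : Omits L F N) {ι : Type} [Finite ι]
    {x : ι → M} {y : ι → N} (hxy : SameType L x y) (b : N) :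
    ∃ a : OneStep L F M, SameType L (adjoin (OneStep.inl L F M ∘ x) a) (adjoin y b) := by
  obtain ⟨r, ⟨e⟩⟩ := Finite.exists_equiv_fin ι
  -- If `b` is already in the tuple no new point is needed; extension problems cover only proper
  -- extensions.
  by_cases hb : b ∈ Set.range y
  · obtain ⟨i, rfl⟩ := hb
    refine ⟨OneStep.inl L F M (x i), ?_⟩
    have h := ((SameType.embedding (OneStep.inl L F M) x).symm.trans hxy).comp
      (fun o : Option ι => o.elim i id)
    convert h using 1 <;>
    · funext o
      cases o <;> rfl
  · let P : ExtensionProblem L F M :=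
      { size := r
        base := x ∘ e.symm
        rel := fun R s => RelMap R (adjoin (y ∘ e.symm) b ∘ s)
        realized := ⟨N, inferInstance, adjoin (y ∘ e.symm) b, hN, hxy.comp e.symm,
          fun i h => hb ⟨_, h⟩, fun _ _ => Iff.rfl⟩ }
    refine ⟨Sum.inr P, ?_⟩
    have h := (P.sameType_tuple (y := adjoin (y ∘ e.symm) b) (hxy.comp e.symm)
      (fun i h => hb ⟨_, h⟩) (fun _ _ => Iff.rfl)).comp (Option.map e)
    convert h using 1
    · funext o
      cases o with
      | none => rfl
      | some i => exact congrArg (Sum.inl ∘ x) (e.symm_apply_apply i).symm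
    · funext o
      cases o with
      | none => rfl
      | some i => exact congrArg y (e.symm_apply_apply i).symm

variable (L F M) in
/-- The iterated free amalgams of one-point extensions. -/
def stage : ℕ → CategoryTheory.Bundled.{0} L.Structure
  | 0 => ⟨M, inferInstance⟩
  | i + 1 => ⟨OneStep L F (stage i), inferInstance⟩

variable (L F M) in
/-- The inclusion of a stage in the next one. -/
def stageSucc (i : ℕ) : stage L F M i ↪[L] stage L F M (i + 1) :=
  OneStep.inl L F (stage L F M i)

variable (L F M) in
/-- The union of the stages. -/
abbrev StageLimit : Type :=
  Language.DirectLimit (fun i => stage L F M i) (DirectedSystem.natLERec (stageSucc L F M))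

variable (L F M) in
/-- The inclusion of a stage in the union. -/
noncomputable def stageOf (i : ℕ) : stage L F M i ↪[L] StageLimit L F M :=
  DirectLimit.of L ℕ (fun i => stage L F M i) (DirectedSystem.natLERec (stageSucc L F M)) i

theorem stageOf_succ (i : ℕ) (x : stage L F M i) :
    stageOf L F M (i + 1) (stageSucc L F M i x) = stageOf L F M i x := by
  have h := DirectLimit.of_f (L := L) (G := fun i => stage L F M i)
    (f := DirectedSystem.natLERec (stageSucc L F M)) (hij := Nat.le_succ i) (x := x)
  rw [stageOf, stageOf, ← h]
  congr 1
  rw [DirectedSystem.coe_natLERec]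
  exact (Nat.leRecOn_succ' (C := fun i => (stage L F M i : Type))
    (next := fun {k} => stageSucc L F M k) x).symm

theorem exists_stageOf_comp {α : Type} [Finite α] (x : α → StageLimit L F M) :
    ∃ (i : ℕ) (y : α → stage L F M i), x = stageOf L F M i ∘ y := by
  obtain ⟨i, y, hy⟩ := DirectLimit.exists_quotient_mk'_sigma_mk'_eq
    (fun i => stage L F M i) (DirectedSystem.natLERec (stageSucc L F M)) x
  exact ⟨i, y, hy⟩

theorem stage_omits (hF : Irreducible L F) (hM : Omits L F M) (i : ℕ) :
    Omits L F (stage L F M i) := by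
  induction i with
  | zero => exact hM
  | succ i ih => exact OneStep.omits hF ih

/-- Finite families lie in some stage: a copy of `F` would appear there, and an extension is
realized one stage later. -/
theorem stageLimit_generic [Finite F] (hF : Irreducible L F) (hM : Omits L F M) :
    Generic L F (StageLimit L F M) := by
  constructor
  · rintro ⟨h, hh⟩
    obtain ⟨i, y, hy⟩ := exists_stageOf_comp h
    refine (stage_omits hF hM i).of_factor (SameType.embedding (stageOf L F M i) id).symm h hh
      fun j => ⟨y j, (congr_fun hy j).symm⟩
  · intro N _ hN ι _ x y hxy b
    obtain ⟨i, x, rfl⟩ := exists_stageOf_comp x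
    obtain ⟨a, ha⟩ := OneStep.extend hN ((SameType.embedding (stageOf L F M i) x).trans hxy) b
    refine ⟨stageOf L F M (i + 1) a, ?_⟩
    have h := (SameType.embedding (stageOf L F M (i + 1)) _).symm.trans ha
    convert h using 1
    funext o
    cases o with
    | none => rfl
    | some j => exact (stageOf_succ i (x j)).symm

theorem exists_generic [Finite F] (hF : Irreducible L F) (hM : Omits L F M) :
    ∃ (K : Type) (_ : L.Structure K), Generic L F K ∧ Nonempty (M ↪[L] K) :=
  ⟨StageLimit L F M, inferInstance, stageLimit_generic hF hM, ⟨stageOf L F M 0⟩⟩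

end Existence

/-! ### Axioms, model completion, completeness and categoricity. -/

section Axioms

variable {L : FirstOrder.Language.{0, 0}} {M N F : Type} [L.Structure M] [L.Structure N]
  [L.Structure F] {κ ι : Type}

open Classical in
/-- `φ` or its negation, according to `p`. -/
noncomputable def literal (p : Prop) (φ : L.Formula κ) : L.Formula κ :=
  if p then φ else φ.not

theorem realize_literal (p : Prop) (φ : L.Formula κ) (x : κ → M) :
    (literal p φ).Realize x ↔ (φ.Realize x ↔ p) := by
  by_cases h : p <;> simp [literal, h]

variable [Finite (Σ p, L.Relations p)]

/-- The conjunction of all literals satisfied by the family `y`. -/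
noncomputable def diagram [Finite κ] (y : κ → N) : L.Formula κ :=
  Formula.iInf (fun q : κ × κ =>
    literal (y q.1 = y q.2) (Term.equal (Term.var q.1) (Term.var q.2))) ⊓
  Formula.iInf (fun q : Σ R : (Σ p, L.Relations p), Fin R.1 → κ =>
    literal (RelMap q.1.2 (y ∘ q.2)) (q.1.2.formula fun i => Term.var (q.2 i)))

theorem realize_diagram [Finite κ] (y : κ → N) (x : κ → M) :
    (diagram (L := L) y).Realize x ↔ SameType L x y := by
  simp only [diagram, Formula.realize_inf, Formula.realize_iInf, realize_literal,
    Formula.realize_equal, Formula.realize_rel, Term.realize_var]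
  exact ⟨fun h => ⟨fun i j => h.1 (i, j), fun {p} R s => h.2 ⟨⟨p, R⟩, s⟩⟩,
    fun h => ⟨fun q => h.eq_iff q.1 q.2, fun q => h.rel_iff q.1.2 q.2⟩⟩

/-- Every tuple with the diagram of `y ∘ some` extends to one with the diagram of `y`. -/
noncomputable def extensionSentence [Finite ι] (y : Option ι → N) : L.Sentence :=
  Formula.iAlls ι (((diagram (y ∘ some)).relabel Sum.inr).imp
    (Formula.iExs Unit ((diagram y).relabel
      (fun o : Option ι => o.elim (Sum.inr ()) (Sum.inl ∘ Sum.inr)))))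

theorem realize_extensionSentence [Finite ι] (y : Option ι → N) :
    M ⊨ extensionSentence (L := L) y ↔ ∀ x : ι → M, SameType L x (y ∘ some) →
      ∃ a, SameType L (adjoin x a) y := by
  have key : ∀ (x : ι → M) (c : Unit → M), (Sum.elim (fun a => Sum.elim (default : Empty → M) x a) c ∘
      fun o : Option ι => o.elim (Sum.inr ()) (Sum.inl ∘ Sum.inr)) = adjoin x (c ()) := by
    intro x c
    funext o
    cases o <;> rfl
  simp only [Sentence.Realize, extensionSentence, Formula.realize_iAlls, Formula.realize_imp,
    Formula.realize_iExs, Formula.realize_relabel, realize_diagram]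
  refine forall_congr' fun x => imp_congr Iff.rfl ⟨?_, ?_⟩
  · rintro ⟨c, hc⟩
    exact ⟨c (), by rw [← key]; exact hc⟩
  · rintro ⟨a, ha⟩
    exact ⟨fun _ => a, by rw [← key x fun _ => a] at ha; exact ha⟩

variable (L F) in
/-- There is no injective homomorphism from `F`. -/
noncomputable def omitsSentence [Finite F] : L.Sentence :=
  Formula.iAlls F (Formula.not
    (Formula.iInf (fun q : {q : Σ R : (Σ p, L.Relations p), Fin R.1 → F // RelMap q.1.2 q.2} =>
      q.1.1.2.formula fun i => Term.var (Sum.inr (q.1.2 i))) ⊓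
    Formula.iInf (fun q : {q : F × F // q.1 ≠ q.2} =>
      Formula.not (Term.equal (Term.var (Sum.inr q.1.1)) (Term.var (Sum.inr q.1.2))))))

theorem realize_omitsSentence [L.IsRelational] [Finite F] :
    M ⊨ omitsSentence L F ↔ Omits L F M := by
  simp only [Sentence.Realize, omitsSentence, Formula.realize_iAlls, Formula.realize_not,
    Formula.realize_inf, Formula.realize_iInf, Formula.realize_rel, Formula.realize_equal,
    Term.realize_var, Sum.elim_inr]
  constructor
  · rintro H ⟨h, hh⟩
    exact H h ⟨fun q => h.map_rel _ _ q.2, fun q hq => q.2 (hh hq)⟩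
  · rintro H x ⟨h₁, h₂⟩
    refine H ⟨⟨x, fun f => isEmptyElim f, fun R w hw => h₁ ⟨⟨⟨_, R⟩, w⟩, hw⟩⟩, fun i j hij => ?_⟩
    by_contra hne
    exact h₂ ⟨(i, j), hne⟩ hij

omit [Finite (Σ p, L.Relations p)] in
theorem isQF_iInf [Finite ι] {f : ι → L.Formula κ} (hf : ∀ i, (f i).IsQF) :
    (Formula.iInf f).IsQF := by
  have H : ∀ l : List ι, BoundedFormula.IsQF ((l.map f).foldr (· ⊓ ·) ⊤) := fun l => by
    induction l with
    | nil => exact .top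
    | cons i l ih => exact (hf i).inf ih
  exact H _

omit [Finite (Σ p, L.Relations p)] in
theorem isUniversal_alls {n : ℕ} {φ : L.BoundedFormula κ n} (h : φ.IsUniversal) :
    BoundedFormula.IsUniversal φ.alls := by
  induction n with
  | zero => exact h
  | succ n ih => exact ih h.all

theorem isUniversal_omitsSentence [Finite F] :
    BoundedFormula.IsUniversal (omitsSentence L F) := by
  refine isUniversal_alls (BoundedFormula.IsQF.isUniversal (.relabel (.not (.inf ?_ ?_)) _))
  · exact isQF_iInf fun q => (BoundedFormula.IsAtomic.rel _ _).isQF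
  · exact isQF_iInf fun q => (BoundedFormula.IsAtomic.equal _ _).isQF.not

variable (L F) in
/-- The theory of the structures omitting `F`. -/
def omitsTheory [Finite F] : L.Theory := {omitsSentence L F}

variable (L F) in
/-- The theory of the generic structures omitting `F`. -/
def genericTheory [Finite F] : L.Theory :=
  insert (omitsSentence L F) {φ | ∃ (N : Type) (_ : L.Structure N) (ι : Type) (_ : Finite ι)
    (y : Option ι → N), Omits L F N ∧ φ = extensionSentence y}

variable [L.IsRelational] [Finite F]

theorem model_omitsTheory : M ⊨ omitsTheory L F ↔ Omits L F M := by
  simp [omitsTheory, realize_omitsSentence]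

theorem model_genericTheory : M ⊨ genericTheory L F ↔ Generic L F M := by
  rw [genericTheory, Theory.model_insert_iff, realize_omitsSentence, Theory.model_iff]
  constructor
  · rintro ⟨h₁, h₂⟩
    exact ⟨h₁, fun N _ hN ι _ x y hxy b => (realize_extensionSentence _).1
      (h₂ _ ⟨N, inferInstance, ι, inferInstance, adjoin y b, hN, rfl⟩) x hxy⟩
  · rintro h
    refine ⟨h.omits, ?_⟩
    rintro _ ⟨N, _, ι, _, y, hN, rfl⟩
    refine (realize_extensionSentence _).2 fun x hx => ?_
    obtain ⟨a, ha⟩ := h.extend N hN _ _ _ hx (y none)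
    refine ⟨a, ?_⟩
    convert ha using 1
    funext o
    cases o <;> rfl

theorem ModelType.generic (M : Theory.ModelType.{0, 0, 0} (genericTheory L F)) : Generic L F M :=
  model_genericTheory.1 M.is_model

theorem exists_model_genericTheory (hF : Irreducible L F) [Nonempty M] (hM : Omits L F M) :
    ∃ K : Theory.ModelType.{0, 0, 0} (genericTheory L F), Nonempty (M ↪[L] K) := by
  obtain ⟨K, _, hK, ⟨f⟩⟩ := exists_generic hF hM
  have : Nonempty K := (inferInstance : Nonempty M).map f
  have : K ⊨ genericTheory L F := model_genericTheory.2 hK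
  exact ⟨Theory.ModelType.of _ K, ⟨f⟩⟩

theorem isModelCompletion_genericTheory (hF : Irreducible L F) :
    IsModelCompletion (genericTheory L F) (omitsTheory L F) where
  models M := model_omitsTheory.2 (ModelType.generic M).omits
  embeds A := exists_model_genericTheory hF (model_omitsTheory.1 A.is_model)
  complete_diagram _ M N f g _ φ a :=
    (ModelType.generic M).formula_realize_iff (ModelType.generic N) φ
      ((SameType.embedding f a).symm.trans (SameType.embedding g a))

-- A single point without relations works, since irreducibility gives a nonempty `F` at least one
-- related tuple.
omit [Finite (Σ p, L.Relations p)] [Finite F] in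
variable (L F) in
theorem exists_omits [Nonempty F] (hF : Irreducible L F) :
    ∃ (M : Type) (_ : L.Structure M), Nonempty M ∧ Omits L F M := by
  let inst : L.Structure Unit := ⟨fun f => isEmptyElim f, fun _ _ => False⟩
  refine ⟨Unit, inst, inferInstance, ?_⟩
  rintro ⟨h, -⟩
  obtain ⟨i⟩ := ‹Nonempty F›
  obtain ⟨p, R, w, hw, -⟩ := hF i i
  exact h.map_rel R w hw

theorem isComplete_genericTheory [IsEmpty (L.Relations 0)] [Nonempty F] (hF : Irreducible L F) :
    (genericTheory L F).IsComplete := by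
  rw [Theory.IsComplete.isComplete_iff_models_elementarily_equivalent]
  constructor
  · obtain ⟨M, _, _, hM⟩ := exists_omits L F hF
    obtain ⟨K, -⟩ := exists_model_genericTheory hF hM
    exact ⟨K⟩
  · intro M N
    refine elementarilyEquivalent_iff.2 fun φ => ?_
    exact (ModelType.generic M).formula_realize_iff (ModelType.generic N) φ (.of_isEmpty _ _)

-- In a relational language finitely generated substructures are finite and adding a generator adds
-- at most one point, so genericity is exactly what is needed.
omit [Finite (Σ p, L.Relations p)] [Finite F] in
theorem Generic.isExtensionPair (hM : Generic L F M) (hN : Generic L F N) :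
    L.IsExtensionPair M N := by
  rw [isExtensionPair_iff_exists_embedding_closure_singleton_sup]
  intro S hS f m
  have : Finite S := hS.finite
  obtain ⟨b, hb⟩ := hN.extend M hM.omits S f (fun s => (s : M))
    ((SameType.embedding f id).symm.trans (SameType.embedding S.subtype id)) m
  have hmem : ∀ z : (Substructure.closure L {m} ⊔ S : L.Substructure M),
      ∃ o : Option S, adjoin (fun s : S => (s : M)) m o = z := by
    rintro ⟨z, hz⟩
    have hz' : z ∈ Substructure.closure L ({m} ∪ S : Set M) := by
      rwa [Substructure.closure_union, Substructure.closure_eq]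
    rw [Substructure.mem_closure_iff_of_isRelational] at hz'
    rcases hz' with rfl | h
    · exact ⟨none, rfl⟩
    · exact ⟨some ⟨z, h⟩, rfl⟩
  choose o ho using hmem
  have hval : adjoin (fun s : S => (s : M)) m ∘ o = Subtype.val := funext ho
  have ht := hb.comp o
  rw [hval] at ht
  refine ⟨⟨⟨adjoin f b ∘ o, fun x y h => Subtype.ext ((ht.eq_iff x y).1 h)⟩,
    fun f => isEmptyElim f, fun R s => ht.rel_iff R s⟩, ?_⟩
  ext s
  exact (hb.eq_iff (some s) (o _)).2 (ho (Substructure.inclusion le_sup_right s)).symm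

theorem categorical_genericTheory [IsEmpty (L.Relations 0)] :
    Cardinal.aleph0.{0}.Categorical (genericTheory L F) := by
  intro M N hM hN
  have : Countable M := Cardinal.mk_le_aleph0_iff.1 hM.le
  have : Countable N := Cardinal.mk_le_aleph0_iff.1 hN.le
  have : IsEmpty L.Constants := inferInstanceAs (IsEmpty (L.Functions 0))
  obtain ⟨f, -⟩ := equiv_between_cg (L := L) (M := M) (N := N) cg_of_countable cg_of_countable
    default ((ModelType.generic M).isExtensionPair (ModelType.generic N))
    ((ModelType.generic N).isExtensionPair (ModelType.generic M))
  exact ⟨f⟩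

end Axioms

/-! ### Ramsey triangles, cycles of length four and NSOP₄. -/

/-- A colouring of the pairs from `ℕ` by finitely many colours has a monochromatic triangle. -/
theorem exists_monochromatic_triangle {C : Type} [Finite C] (c : ℕ → ℕ → C) :
    ∃ i j l, i < j ∧ j < l ∧ c i j = c i l ∧ c i j = c j l := by
  have hlt : ∀ i : ℕ, ∀ᶠ j in (Filter.hyperfilter ℕ : Filter ℕ), i < j := fun i =>
    Nat.hyperfilter_le_atTop (Filter.eventually_gt_atTop i)
  have hlim : ∀ f : ℕ → C, ∃ a, ∀ᶠ j in (Filter.hyperfilter ℕ : Filter ℕ), f j = a := fun f =>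
    Ultrafilter.eventually_exists_iff.1 (Filter.Eventually.of_forall fun j => ⟨f j, rfl⟩)
  -- `d i` is the colour of `c i j` for almost all `j`, and `e` below is the value of `d i` for
  -- almost all `i`, with respect to the ultrafilter.
  choose d hd using fun i => hlim (c i)
  obtain ⟨e, he⟩ := hlim d
  obtain ⟨i, hi⟩ := he.exists
  obtain ⟨j, ⟨hij, hcij⟩, hj⟩ := (((hlt i).and (hd i)).and he).exists
  obtain ⟨l, ⟨hjl, hcjl⟩, hcil⟩ := (((hlt j).and (hd j)).and (hd i)).exists
  exact ⟨i, j, l, hij, hjl, hcij.trans hcil.symm, by rw [hcij, hcjl, hi, hj]⟩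

section Cycle

variable {L : FirstOrder.Language.{0, 0}} {M F : Type} [L.Structure M] [L.Structure F]

variable (L) in
/-- The equalities and relations satisfied by a family. -/
def pattern {κ : Type} (x : κ → M) :
    (κ × κ → Prop) × ((Σ R : (Σ p, L.Relations p), Fin R.1 → κ) → Prop) :=
  (fun q => x q.1 = x q.2, fun q => RelMap q.1.2 (x ∘ q.2))

theorem sameType_of_pattern_eq {κ : Type} {x y : κ → M} (h : pattern L x = pattern L y) :
    SameType L x y :=
  ⟨fun i j => iff_of_eq (congr_fun (congr_arg Prod.fst h) (i, j)),
    fun R s => iff_of_eq (congr_fun (congr_arg Prod.snd h) ⟨⟨_, R⟩, s⟩)⟩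

theorem exists_sameType_triangle [Finite (Σ p, L.Relations p)] {m : ℕ} (a : ℕ → Fin m → M) :
    ∃ i j l, i < j ∧ j < l ∧ SameType L (Sum.elim (a i) (a j)) (Sum.elim (a i) (a l)) ∧
      SameType L (Sum.elim (a i) (a j)) (Sum.elim (a j) (a l)) := by
  obtain ⟨i, j, l, hij, hjl, h₁, h₂⟩ :=
    exists_monochromatic_triangle fun i j => pattern L (Sum.elim (a i) (a j))
  exact ⟨i, j, l, hij, hjl, sameType_of_pattern_eq h₁, sameType_of_pattern_eq h₂⟩

variable {m : ℕ} (a b : Fin m → M)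

/-- The universe for a cycle of four copies of `a`, sharing the coordinates where `a` and `b`
agree. -/
def CycleGlue (_a _b : Fin m → M) : Type := M × Option (Fin 4)

open Classical in
/-- The `i`-th copy of `a`. -/
noncomputable def cyclePoint (i : Fin 4) (l : Fin m) : CycleGlue a b :=
  (a l, if a l = b l then none else some i)

/-- Two consecutive copies of `a`. -/
noncomputable def cyclePair (i : Fin 4) : Fin m ⊕ Fin m → CycleGlue a b :=
  Sum.elim (cyclePoint a b i) (cyclePoint a b (i + 1))

/-- Relations hold only within two consecutive copies, where they are those of `a` followed by `b`.
-/
noncomputable instance [L.IsRelational] : L.Structure (CycleGlue a b) where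
  funMap := fun f _ => isEmptyElim f
  RelMap := fun R z => ∃ i s, z = cyclePair a b i ∘ s ∧ RelMap R (Sum.elim a b ∘ s)

variable {a b} {c : Fin m → M}

open Classical in
theorem cyclePoint_snd {i : Fin 4} {l : Fin m} :
    (cyclePoint a b i l).2 = if a l = b l then none else some i := rfl

open Classical in
theorem cyclePoint_eq_iff {i j : Fin 4} {l l' : Fin m} :
    cyclePoint a b i l = cyclePoint a b j l' ↔
      a l = a l' ∧ ((a l = b l ↔ a l' = b l') ∧ (a l = b l ∨ i = j)) := by
  refine Prod.ext_iff.trans (and_congr_right fun _ => ?_)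
  rw [cyclePoint_snd, cyclePoint_snd]
  by_cases h : a l = b l <;> by_cases h' : a l' = b l' <;> simp [h, h']

section Indiscernible

/-- Comparison with `c` turns `a l = b l'` into `a l = c l'` and `b l = c l'`. So `a` and `b` meet
only in coordinates on which they agree, which are the shared ones. -/
theorem agree_of_eq (h₁ : SameType L (Sum.elim a b) (Sum.elim a c))
    (h₂ : SameType L (Sum.elim a b) (Sum.elim b c)) {l l' : Fin m} (h : a l = b l') :
    a l = b l ∧ a l = a l' := by
  have h3 : a l = c l' := (h₁.eq_iff (.inl l) (.inr l')).1 h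
  have h4 : b l = c l' := (h₂.eq_iff (.inl l) (.inr l')).1 h
  have h6 : b l' = c l' := h.symm.trans h3
  have h7 : a l' = b l' := (h₂.eq_iff (.inl l') (.inr l')).2 h6
  exact ⟨h3.trans h4.symm, h.trans h7.symm⟩

theorem agree_congr (h₂ : SameType L (Sum.elim a b) (Sum.elim b c)) {l l' : Fin m}
    (h : a l = a l') : a l = b l ↔ a l' = b l' := by
  have : b l = b l' := (h₂.eq_iff (.inl l) (.inl l')).1 h
  rw [h, this]

theorem cyclePoint_eq_iff_of_sameType (h₂ : SameType L (Sum.elim a b) (Sum.elim b c))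
    {i j : Fin 4} {l l' : Fin m} :
    cyclePoint a b i l = cyclePoint a b j l' ↔ a l = a l' ∧ (a l = b l ∨ i = j) := by
  rw [cyclePoint_eq_iff]
  exact ⟨fun h => ⟨h.1, h.2.2⟩, fun h => ⟨h.1, agree_congr h₂ h.1, h.2⟩⟩

/-- Three consecutive copies are read as `a`, `b`, `c`; overlapping pairs then give a common point
the same value. -/
theorem elim_eq_of_cyclePair_eq_succ (h₂ : SameType L (Sum.elim a b) (Sum.elim b c))
    {i : Fin 4} {q q' : Fin m ⊕ Fin m} (h : cyclePair a b i q = cyclePair a b (i + 1) q') :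
    Sum.elim a b q = Sum.elim b c q' := by
  have hi : i ≠ i + 1 := by clear h; revert i; decide
  have hi' : i ≠ i + 1 + 1 := by clear h; revert i; decide
  have hbc : ∀ l, a l = b l → b l = c l := fun l => (h₂.eq_iff (.inl l) (.inr l)).1
  rcases q with l | l <;> rcases q' with l' | l' <;>
    obtain ⟨h, h'⟩ := (cyclePoint_eq_iff_of_sameType h₂).1 h
  · have := h'.resolve_right hi
    exact h.trans ((agree_congr h₂ h).1 this)
  · have := (agree_congr h₂ h).1 (h'.resolve_right hi')
    exact h.trans (this.trans (hbc _ this))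
  · exact (h₂.eq_iff (.inl l) (.inl l')).1 h
  · have hl := h'.resolve_right (by simp)
    have := (agree_congr h₂ h).1 hl
    exact hl.symm.trans (h.trans (this.trans (hbc _ this)))

/-- Opposite pairs have no copy in common, so they meet only in shared coordinates. -/
theorem elim_eq_of_cyclePair_eq (h₂ : SameType L (Sum.elim a b) (Sum.elim b c)) {i j : Fin 4}
    (hij : i = j ∨ i = j + 2) {q q' : Fin m ⊕ Fin m}
    (h : cyclePair a b i q = cyclePair a b j q') : Sum.elim a b q = Sum.elim a b q' := by
  have hi : i ≠ j + 1 := by clear h; revert i j; decide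
  have hi' : i + 1 ≠ j := by clear h; revert i j; decide
  rcases q with l | l <;> rcases q' with l' | l' <;>
    obtain ⟨h, h'⟩ := (cyclePoint_eq_iff_of_sameType h₂).1 h
  · exact h
  · exact h.trans ((agree_congr h₂ h).1 (h'.resolve_right hi))
  · exact (h'.resolve_right hi').symm.trans h
  · exact (h₂.eq_iff (.inl l) (.inl l')).1 h

theorem cyclePair_eq_of_elim_eq (h₁ : SameType L (Sum.elim a b) (Sum.elim a c))
    (h₂ : SameType L (Sum.elim a b) (Sum.elim b c)) {i : Fin 4} {q q' : Fin m ⊕ Fin m}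
    (h : Sum.elim a b q = Sum.elim a b q') : cyclePair a b i q = cyclePair a b i q' := by
  rcases q with l | l <;> rcases q' with l' | l' <;>
    refine (cyclePoint_eq_iff_of_sameType h₂).2 ?_
  · exact ⟨h, .inr rfl⟩
  · exact ⟨(agree_of_eq h₁ h₂ h).2, .inl (agree_of_eq h₁ h₂ h).1⟩
  · have := agree_of_eq h₁ h₂ h.symm
    exact ⟨this.2.symm, .inl ((agree_congr h₂ this.2).1 this.1)⟩
  · exact ⟨(h₂.eq_iff (.inl l) (.inl l')).2 h, .inr rfl⟩

variable [L.IsRelational]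

theorem sameType_cyclePair (h₁ : SameType L (Sum.elim a b) (Sum.elim a c))
    (h₂ : SameType L (Sum.elim a b) (Sum.elim b c)) (i : Fin 4) :
    SameType L (cyclePair a b i) (Sum.elim a b) := by
  refine ⟨fun q q' => ⟨elim_eq_of_cyclePair_eq h₂ (.inl rfl), cyclePair_eq_of_elim_eq h₁ h₂⟩,
    fun {p} R s => ⟨?_, fun h => ⟨i, s, rfl, h⟩⟩⟩
  rintro ⟨j, s', h, hs'⟩
  -- A relation on pair `i` may have been imposed by another pair `j`. For neighbouring pairs, the
  -- equality of the types of `ab` and `bc` makes the two prescriptions agree.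
  have hij : i = j ∨ i = j + 2 ∨ j = i + 1 ∨ i = j + 1 := by
    clear h; revert i j; decide
  rcases hij with hij | hij | rfl | rfl
  · rwa [show Sum.elim a b ∘ s = Sum.elim a b ∘ s' from
      funext fun t => elim_eq_of_cyclePair_eq h₂ (.inl hij) (congr_fun h t)]
  · rwa [show Sum.elim a b ∘ s = Sum.elim a b ∘ s' from
      funext fun t => elim_eq_of_cyclePair_eq h₂ (.inr hij) (congr_fun h t)]
  · rw [show Sum.elim a b ∘ s = Sum.elim b c ∘ s' from
      funext fun t => elim_eq_of_cyclePair_eq_succ h₂ (congr_fun h t)]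
    exact (h₂.rel_iff R s').1 hs'
  · rw [show Sum.elim a b ∘ s' = Sum.elim b c ∘ s from
      funext fun t => elim_eq_of_cyclePair_eq_succ h₂ (congr_fun h t).symm] at hs'
    exact (h₂.rel_iff R s).2 hs'

end Indiscernible

open Classical in
theorem eq_or_eq_of_mem_range_cyclePair {i j : Fin 4} {z : CycleGlue a b}
    (h : z ∈ Set.range (cyclePair a b i)) (hz : z.2 = some j) : j = i ∨ j = i + 1 := by
  obtain ⟨l | l, rfl⟩ := h
  · exact .inl (by simpa [cyclePair, cyclePoint_snd, eq_comm] using hz : _ ∧ j = i).2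
  · exact .inr (by simpa [cyclePair, cyclePoint_snd, eq_comm] using hz : _ ∧ j = i + 1).2

theorem mem_range_cyclePair {i j : Fin 4} {z : CycleGlue a b}
    (h : z ∈ Set.range (cyclePair a b j)) (hz : ∀ t, z.2 = some t → t = i ∨ t = i + 1) :
    z ∈ Set.range (cyclePair a b i) := by
  obtain ⟨j, l, rfl⟩ : ∃ j l, cyclePoint a b j l = z := by
    obtain ⟨l | l, rfl⟩ := h
    exacts [⟨_, _, rfl⟩, ⟨_, _, rfl⟩]
  by_cases hl : a l = b l
  · exact ⟨.inl l, cyclePoint_eq_iff.2 ⟨rfl, Iff.rfl, .inl hl⟩⟩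
  · rcases hz j (if_neg hl) with rfl | rfl
    exacts [⟨.inl l, rfl⟩, ⟨.inr l, rfl⟩]

variable [L.IsRelational]

theorem cycleGlue_omits (hF : Irreducible L F) (hM : Omits L F M)
    (h₁ : SameType L (Sum.elim a b) (Sum.elim a c))
    (h₂ : SameType L (Sum.elim a b) (Sum.elim b c)) : Omits L F (CycleGlue a b) := by
  classical
  rintro ⟨h, hh⟩
  have hpair : ∀ u v : F, ∃ i, h u ∈ Set.range (cyclePair a b i) ∧
      h v ∈ Set.range (cyclePair a b i) := by
    intro u v
    obtain ⟨p, R, w, hw, ⟨s, rfl⟩, ⟨t, rfl⟩⟩ := hF u v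
    obtain ⟨i, q, hq, -⟩ := h.map_rel R w hw
    exact ⟨i, ⟨q s, (congr_fun hq s).symm⟩, ⟨q t, (congr_fun hq t).symm⟩⟩
  -- Length four matters here: the 4-cycle has no triangle, so pairwise equal or adjacent indices
  -- lie on one edge.
  have hdec : ∀ S : Finset (Fin 4), (∀ i ∈ S, ∀ j ∈ S, i = j ∨ j = i + 1 ∨ i = j + 1) →
      ∃ i, ∀ j ∈ S, j = i ∨ j = i + 1 := by decide
  obtain ⟨i, hi⟩ := hdec {j | ∃ u, (h u).2 = some j} (by
    intro i hi j hj
    obtain ⟨u, hu⟩ := (Finset.mem_filter.1 hi).2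
    obtain ⟨v, hv⟩ := (Finset.mem_filter.1 hj).2
    obtain ⟨t, htu, htv⟩ := hpair u v
    rcases eq_or_eq_of_mem_range_cyclePair htu hu with rfl | rfl <;>
    rcases eq_or_eq_of_mem_range_cyclePair htv hv with rfl | rfl <;> simp)
  refine hM.of_factor (sameType_cyclePair h₁ h₂ i) h hh fun u => ?_
  obtain ⟨j, hj, -⟩ := hpair u u
  exact mem_range_cyclePair hj fun t ht => hi t (Finset.mem_filter.2 ⟨Finset.mem_univ _, u, ht⟩)

theorem not_hasSOP_genericTheory [Finite (Σ p, L.Relations p)] [IsEmpty (L.Relations 0)] [Finite F]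
    (hF : Irreducible L F) : ¬ HasSOP (genericTheory L F) 4 := by
  rintro ⟨m, φ, M, ⟨a, ha⟩, hcycle⟩
  have hM := ModelType.generic M
  obtain ⟨i, j, l, hij, -, h₁, h₂⟩ := exists_sameType_triangle (L := L) a
  obtain ⟨y, hy⟩ := hM.exists_sameType_of_finite (cycleGlue_omits hF hM.omits h₁ h₂)
    (fun q : Fin 4 × Fin m => cyclePoint (a i) (a j) q.1 q.2)
  refine hcycle ⟨fun t l => y (t, l), fun t => ?_⟩
  refine (hM.formula_realize_iff hM φ ?_).2 (ha i j hij)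
  rw [finRotate_apply]
  have h := (hy.comp (Sum.elim (Prod.mk t) (Prod.mk (t + 1)))).trans
    (z := Sum.elim (a i) (a j)) (by
      convert sameType_cyclePair h₁ h₂ t using 1
      funext q
      cases q <;> rfl)
  convert h using 1
  funext q
  cases q <;> rfl

end Cycle

/-! ### The vocabulary, the forbidden configuration and the olive formulas. -/

variable {n : ℕ} (k : Fin 2 → ℕ) (η : Fin n → Fin 2)

instance : (oliveLang k).IsRelational := fun _ => inferInstanceAs (IsEmpty Empty)

/-- The binary symbol `P`. -/
def oliveP : (oliveLang k).Relations 2 := OliveRel.P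

/-- The symbol `Q_ι`. -/
def oliveQ (ι : Fin 2) : (oliveLang k).Relations (k ι + 1) := OliveRel.Q ι

instance : IsEmpty ((oliveLang k).Relations 0) :=
  ⟨fun R => by
    generalize hp : 0 = p at R
    change OliveRel k p at R
    cases R <;> omega⟩

instance : Finite (Σ p, (oliveLang k).Relations p) := by
  refine Finite.of_surjective
    (fun o : Option (Fin 2) => (o.elim ⟨2, OliveRel.P⟩ fun ι => ⟨k ι + 1, OliveRel.Q ι⟩ :
      Σ p, OliveRel k p)) ?_
  rintro ⟨p, R⟩
  cases R with
  | P => exact ⟨none, rfl⟩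
  | Q ι => exact ⟨some ι, rfl⟩

instance : Finite (Forbidden k η) := inferInstanceAs (Finite (Fin (n + 1)))

instance : Nonempty (Forbidden k η) := inferInstanceAs (Nonempty (Fin (n + 1)))

instance : Countable (oliveLang k).Symbols := by
  unfold FirstOrder.Language.Symbols
  infer_instance

theorem irreducible_forbidden (hn : 0 < n) : Irreducible (oliveLang k) (Forbidden k η) := by
  have key : ∀ i j : Fin (n + 1), i < j → ∀ u v : Fin (n + 1), (u = i ∨ u = j) → (v = i ∨ v = j) →
      ∃ (p : ℕ) (R : (oliveLang k).Relations p) (w : Fin p → Forbidden k η),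
        RelMap R w ∧ u ∈ Set.range w ∧ v ∈ Set.range w := by
    intro i j hij u v hu hv
    have hmem : ∀ u : Fin (n + 1), (u = i ∨ u = j) → u ∈ Set.range ![i, j] := by simp
    exact ⟨2, oliveP k, ![i, j], hij, hmem u hu, hmem v hv⟩
  intro u v
  change Fin (n + 1) at u v
  rcases lt_trichotomy u v with h | rfl | h
  · exact key u v h u v (.inl rfl) (.inr rfl)
  · rcases eq_or_ne u 0 with rfl | h
    · exact key 0 (Fin.last n) (Fin.pos_iff_ne_zero.2 (by simpa [Fin.ext_iff] using hn.ne')) _ _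
        (.inl rfl) (.inl rfl)
    · exact key 0 u (Fin.pos_iff_ne_zero.2 h) u u (.inr rfl) (.inr rfl)
  · exact key v u h u v (.inr rfl) (.inl rfl)

/-- The formula `P(x₀, x_j) ∧ x₀ ≠ x_j`, together with `Q_ι(x₀, …, x_j)` when `j = k_ι`. -/
noncomputable def oliveFormula (ι : Fin 2) (j : ℕ) : (oliveLang k).Formula (Fin (j + 1) × Fin 1) :=
  ((oliveP k).formula
    ![Term.var (0, 0), Term.var (Fin.last j, 0)]) ⊓
  (Formula.not (Term.equal (Term.var (0, 0)) (Term.var (Fin.last j, 0))) ⊓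
  if h : j = k ι then
    (oliveQ k ι).formula fun i => Term.var (Fin.cast (by rw [h]) i, 0)
  else ⊤)

variable {k η} {M : Type} [(oliveLang k).Structure M]

theorem realize_oliveFormula (ι : Fin 2) (j : ℕ) (v : Fin (j + 1) × Fin 1 → M) :
    (oliveFormula k ι j).Realize v ↔
      RelMap (oliveP k) ![v (0, 0), v (Fin.last j, 0)] ∧
      v (0, 0) ≠ v (Fin.last j, 0) ∧
      ∀ h : j = k ι, RelMap (oliveQ k ι)
        fun i => v (Fin.cast (by rw [h]) i, 0) := by
  have hP : (fun i => (![Term.var (0, 0), Term.var (Fin.last j, 0)] i :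
      (oliveLang k).Term (Fin (j + 1) × Fin 1)).realize v) =
      ![v (0, 0), v (Fin.last j, 0)] := by
    funext i
    fin_cases i <;> rfl
  rw [oliveFormula, Formula.realize_inf, Formula.realize_inf, Formula.realize_rel, hP,
    Formula.realize_not, Formula.realize_equal]
  refine and_congr Iff.rfl (and_congr Iff.rfl ?_)
  split_ifs with h
  · rw [Formula.realize_rel]
    exact ⟨fun H _ => H, fun H => H h⟩
  · simp [h]

theorem realizeBlocks_oliveFormula (ι : Fin 2) {j : ℕ} (hj : 0 < j) (a : Fin j → Fin 1 → M)
    (b : Fin 1 → M) :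
    RealizeBlocks (oliveFormula k ι j) a b ↔
      RelMap (oliveP k) ![a ⟨0, hj⟩ 0, b 0] ∧ a ⟨0, hj⟩ 0 ≠ b 0 ∧
      ∀ h : j = k ι, RelMap (oliveQ k ι)
        (Fin.snoc (α := fun _ => M) (fun i => a (Fin.cast h.symm i) 0) (b 0)) := by
  rw [RealizeBlocks, realize_oliveFormula]
  have h0 : (0 : Fin (j + 1)) = Fin.castSucc ⟨0, hj⟩ := rfl
  simp only [Fin.snoc_last]
  rw [h0, Fin.snoc_castSucc]
  refine and_congr Iff.rfl (and_congr Iff.rfl (forall_congr' fun h => ?_))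
  subst h
  rw [iff_iff_eq]
  congr 1
  funext i
  induction i using Fin.lastCases <;> simp

/-- The instances with `j = 1` give `P` and distinctness for all pairs, those with `j = k ι` give
`Q_ι`: together, an injective homomorphism from the forbidden configuration. -/
theorem not_realizesConfig (hk1 : ∀ ι : Fin 2, 1 ≤ k ι) (hM : OmitsForbidden k η M) :
    ¬ RealizesConfig M η k (oliveFormula k) := by
  rintro ⟨a, ha⟩
  have hpair : ∀ i j : Fin (n + 1), i < j →
      RelMap (oliveP k) ![a i 0, a j 0] ∧ a i 0 ≠ a j 0 := by
    intro i j hij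
    obtain ⟨i, rfl⟩ := Fin.exists_castSucc_eq.2 (Fin.ne_last_of_lt hij)
    have h := ha (η i) 1 le_rfl (hk1 _) (fun _ => i) j (Subsingleton.strictMono _) (fun _ => rfl)
      fun _ => hij
    rw [realizeBlocks_oliveFormula _ one_pos] at h
    exact ⟨h.1, h.2.1⟩
  refine hM ⟨⟨fun i : Fin (n + 1) => a i 0, fun f => isEmptyElim f, fun {p} R => ?_⟩, ?_⟩
  · change OliveRel k p at R
    cases R with
    | P =>
      intro x hx
      change RelMap (oliveP k) _
      convert (hpair (x 0) (x 1) hx).1 using 1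
      funext i
      fin_cases i <;> rfl
    | Q ι =>
      rintro x ⟨s, e, hs, hη, he, rfl⟩
      have h := ha ι (k ι) (hk1 ι) le_rfl s e hs hη he
      rw [realizeBlocks_oliveFormula _ (hk1 ι)] at h
      change RelMap (oliveQ k ι) _
      convert h.2.2 rfl using 1
      exact Fin.comp_snoc (fun i : Fin (n + 1) => a i 0) (fun i => (s i).castSucc) e
  · intro i j hij
    rcases lt_trichotomy (α := Fin (n + 1)) i j with h | h | h
    · exact absurd hij (hpair i j h).2
    · exact h
    · exact absurd hij.symm (hpair j i h).2

/-! ### The structure of all colourings and the olive property. -/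

/-- The disjoint union, over all `g : W → W → {0, 1}`, of the structures on `W` in which `P` is the
order and `Q_ι(x₀, …, x_k)` holds when `x` is increasing and `g x_k` is constantly `ι` on
`[x₀, x_{k-1}]`. -/
def Colourings (_k : Fin 2 → ℕ) (W : Type) : Type := (W → W → Fin 2) × W

variable {W : Type} [LinearOrder W]

instance : (oliveLang k).Structure (Colourings k W) where
  funMap := fun F _ => Empty.elim F
  RelMap := fun {_} R =>
    match R with
    | OliveRel.P => fun x : Fin 2 → Colourings k W => (x 0).1 = (x 1).1 ∧ (x 0).2 < (x 1).2
    | OliveRel.Q ι => fun x : Fin (k ι + 1) → Colourings k W =>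
        (∀ i, (x i).1 = (x (Fin.last _)).1) ∧ StrictMono (fun i => (x i).2) ∧
          ∀ (i i' : Fin (k ι)) (γ : W), (x i.castSucc).2 ≤ γ → γ ≤ (x i'.castSucc).2 →
            (x (Fin.last _)).1 (x (Fin.last _)).2 γ = ι

theorem exists_strictMono_through {ι : Fin 2} (hη : k ι ≤ Nat.card {l : Fin n // η l = ι})
    (t : Finset (Fin n)) (ht : ∀ l ∈ t, η l = ι) (hcard : t.card ≤ k ι) :
    ∃ s : Fin (k ι) → Fin n, StrictMono s ∧ (∀ i, η (s i) = ι) ∧ ∀ l ∈ t, ∃ i, s i = l := by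
  obtain ⟨u, htu, hu, hcu⟩ := Finset.exists_subsuperset_card_eq
    (s := t) (t := Finset.univ.filter fun l => η l = ι) (fun l hl => by simpa using ht l hl) hcard
    (by rwa [Nat.card_eq_fintype_card, Fintype.card_subtype] at hη)
  refine ⟨u.orderEmbOfFin hcu, (u.orderEmbOfFin hcu).strictMono, fun i => ?_, fun l hl => ?_⟩
  · simpa using hu (u.orderEmbOfFin_mem hcu i)
  · have : l ∈ Set.range (u.orderEmbOfFin hcu) := by
      rw [Finset.range_orderEmbOfFin]
      exact htu hl
    exact this

theorem colourings_omits (hk1 : ∀ ι : Fin 2, 1 ≤ k ι)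
    (hη : ∀ ι : Fin 2, k ι ≤ Nat.card {l : Fin n // η l = ι})
    (hgap : ∃ ι : Fin 2, 2 ≤ k ι ∧
      ∃ a b c : Fin n, a < b ∧ b < c ∧ η a = ι ∧ η b ≠ ι ∧ η c = ι) :
    OmitsForbidden k η (Colourings k W) := by
  rintro ⟨h, -⟩
  obtain ⟨ι, hι, a, b, c, hab, hbc, ha, hb, hc⟩ := hgap
  let p : Fin (n + 1) → Colourings k W := h
  have hmono : ∀ i j : Fin (n + 1), i < j → (p i).2 < (p j).2 := fun i j hij =>
    (h.map_rel (oliveP k) ![i, j] hij).2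
  have hconst : ∀ (ι : Fin 2) (t : Finset (Fin n)), (∀ l ∈ t, η l = ι) → t.card ≤ k ι →
      ∀ l ∈ t, ∀ l' ∈ t, ∀ γ : W, (p l.castSucc).2 ≤ γ → γ ≤ (p l'.castSucc).2 →
        (p (Fin.last n)).1 (p (Fin.last n)).2 γ = ι := by
    intro ι t ht hcard l hl l' hl' γ hγ hγ'
    obtain ⟨s, hs, hsη, hst⟩ := exists_strictMono_through (hη ι) t ht hcard
    obtain ⟨i, rfl⟩ := hst l hl
    obtain ⟨i', rfl⟩ := hst l' hl'
    have hQ := (h.map_rel (oliveQ k ι) _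
      ⟨s, Fin.last n, hs, hsη, fun i => Fin.castSucc_lt_last _, rfl⟩).2.2 i i' γ
    have hx : ∀ (x : Fin (n + 1)) (y : Fin (k ι) → Fin (n + 1)),
        (∀ i : Fin (k ι), (h ∘ Fin.snoc (α := fun _ => Fin (n + 1)) y x) i.castSucc = p (y i)) ∧
        (h ∘ Fin.snoc (α := fun _ => Fin (n + 1)) y x) (Fin.last _) = p x :=
      fun x y => ⟨fun i => congrArg p (Fin.snoc_castSucc ..), congrArg p (Fin.snoc_last ..)⟩
    rw [(hx _ _).1, (hx _ _).1, (hx _ _).2] at hQ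
    exact hQ hγ hγ'
  -- Some `Q_ι`-tuple ending at the top passes through both `a` and `c`, because `k ι ≥ 2`; its
  -- interval contains the image of `b`.
  have h1 := hconst ι {a, c} (by simp [ha, hc]) (Finset.card_le_two.trans hι) a (by simp) c
    (by simp) (p b.castSucc).2 (hmono _ _ hab).le (hmono _ _ hbc).le
  have h2 := hconst (η b) {b} (by simp) (by simpa using hk1 _) b (by simp) b (by simp)
    (p b.castSucc).2 le_rfl le_rfl
  exact hb (h2.symm.trans h1)

theorem realizesAll_of_embedding (lam : Ordinal.{0}) [Nonempty M]
    (e : Colourings k lam.ToType ↪[oliveLang k] M) :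
    RealizesAll M k (oliveFormula k) lam := by
  classical
  intro f
  let g : lam.ToType → lam.ToType → Fin 2 := fun x y => f x.toOrd y.toOrd
  let pt : Set.Iio lam → Colourings k lam.ToType := fun α => (g, Ordinal.ToType.mk α)
  -- The points lie in the component indexed by `f` itself; values at `α ≥ lam` are irrelevant.
  refine ⟨fun α _ => if h : α < lam then e (pt ⟨α, h⟩) else Classical.arbitrary M, ?_⟩
  intro ι j hj _ s β hs hsβ hβ hf
  have hsl : ∀ i, s i < lam := fun i => (hsβ i).trans hβ
  rw [realizeBlocks_oliveFormula _ hj]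
  simp only [hsl, hβ, dif_pos]
  have hlt : (pt ⟨s ⟨0, hj⟩, hsl _⟩).2 < (pt ⟨β, hβ⟩).2 :=
    Ordinal.ToType.mk.strictMono (hsβ ⟨0, hj⟩)
  refine ⟨?_, fun h => hlt.ne (congrArg Prod.snd (e.injective h)), ?_⟩
  · have : RelMap (oliveP k) ![pt ⟨s ⟨0, hj⟩, hsl _⟩, pt ⟨β, hβ⟩] := ⟨rfl, hlt⟩
    rw [← e.map_rel] at this
    convert this using 1
    funext i
    fin_cases i <;> rfl
  · rintro rfl
    let t : Fin (k ι + 1) → Set.Iio lam := Fin.snoc (fun i => ⟨s i, hsl i⟩) ⟨β, hβ⟩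
    have ht : ∀ i : Fin (k ι), t i.castSucc = ⟨s i, hsl i⟩ := fun i => Fin.snoc_castSucc ..
    have ht' : t (Fin.last _) = ⟨β, hβ⟩ := Fin.snoc_last ..
    have hmono : StrictMono t := by
      intro i i' hii
      obtain ⟨i, rfl⟩ := Fin.exists_castSucc_eq.2 (Fin.ne_last_of_lt hii)
      induction i' using Fin.lastCases with
      | last =>
        rw [ht, ht']
        exact hsβ i
      | cast i' =>
        rw [ht, ht]
        exact hs (Fin.castSucc_lt_castSucc_iff.1 hii)
    have hQ : RelMap (oliveQ k ι) (pt ∘ t) := by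
      refine ⟨fun _ => rfl, Ordinal.ToType.mk.strictMono.comp hmono, fun i i' γ h h' => ?_⟩
      obtain ⟨γ, rfl⟩ := Ordinal.ToType.mk.surjective γ
      have h := Ordinal.ToType.mk.le_iff_le.1 h
      have h' := Ordinal.ToType.mk.le_iff_le.1 h'
      rw [ht] at h h'
      change f (Ordinal.ToType.toOrd (Ordinal.ToType.mk (t (Fin.last _))))
        (Ordinal.ToType.toOrd (Ordinal.ToType.mk γ)) = ι
      have hmk : ∀ x : Set.Iio lam, (Ordinal.ToType.mk x).toOrd = x :=
        Ordinal.ToType.mk.symm_apply_apply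
      rw [hmk, hmk, ht']
      exact hf i i' γ h h'
    rw [← e.map_rel] at hQ
    convert hQ using 1
    exact (Fin.comp_snoc (e ∘ pt) _ _).symm

theorem hasOlive_genericTheory (hn : 0 < n) (hk1 : ∀ ι : Fin 2, 1 ≤ k ι)
    (hη : ∀ ι : Fin 2, k ι ≤ Nat.card {l : Fin n // η l = ι})
    (hgap : ∃ ι : Fin 2, 2 ≤ k ι ∧
      ∃ a b c : Fin n, a < b ∧ b < c ∧ η a = ι ∧ η b ≠ ι ∧ η c = ι) :
    HasOlive (genericTheory (oliveLang k) (Forbidden k η)) η k 1 := by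
  have hF := irreducible_forbidden k η hn
  refine ⟨oliveFormula k, fun lam => ?_, fun M => not_realizesConfig hk1 (ModelType.generic M).omits⟩
  -- For `lam = 0` the structure of colourings is empty, so any model is used instead.
  rcases eq_or_ne lam 0 with rfl | hlam
  · obtain ⟨M⟩ := (isComplete_genericTheory hF).1
    exact ⟨M, fun f => ⟨fun _ _ => Classical.arbitrary M, fun _ _ _ _ _ _ _ _ hβ =>
      absurd hβ not_lt_zero⟩⟩
  · have := Ordinal.nonempty_toType_iff.2 hlam
    have : Nonempty (Colourings k lam.ToType) :=
      inferInstanceAs (Nonempty ((lam.ToType → lam.ToType → Fin 2) × lam.ToType))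
    obtain ⟨M, ⟨e⟩⟩ := exists_model_genericTheory hF (M := Colourings k lam.ToType)
      (colourings_omits hk1 hη hgap)
    exact ⟨M, realizesAll_of_embedding lam e⟩

end Olive

theorem claim1p5 (n : ℕ) (k : Fin 2 → ℕ) (η : Fin n → Fin 2)
    (hn : k 0 + k 1 ≤ n) (hk : 3 ≤ k 0 + k 1)
    (hk1 : ∀ ι : Fin 2, 1 ≤ k ι)
    (hη : ∀ ι : Fin 2, k ι ≤ Nat.card {l : Fin n // η l = ι})
    (hgap : ∃ ι : Fin 2, 2 ≤ k ι ∧ ∃ a b c : Fin n, a < b ∧ b < c ∧ η a = ι ∧ η b ≠ ι ∧ η c = ι) :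
    ∃ T : (Olive.oliveLang k).Theory,
      (Olive.oliveLang k).card ≤ Cardinal.aleph0.{0} ∧ T.Countable ∧
      T.IsComplete ∧
      Cardinal.aleph0.{0}.Categorical T ∧
      ¬ Olive.HasSOP T 4 ∧
      Olive.HasOlive T η k 1 ∧
      ∃ T₀ : (Olive.oliveLang k).Theory,
        (∀ φ ∈ T₀, FirstOrder.Language.BoundedFormula.IsUniversal φ) ∧
        (∀ (M : Type) [(Olive.oliveLang k).Structure M] [Nonempty M],
          M ⊨ T₀ ↔ Olive.OmitsForbidden k η M) ∧
        Olive.IsModelCompletion T T₀ := by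
  have hn0 : 0 < n := by omega
  have hF := Olive.irreducible_forbidden k η hn0
  refine ⟨Olive.genericTheory _ (Olive.Forbidden k η), Cardinal.mk_le_aleph0, Set.to_countable _,
    Olive.isComplete_genericTheory hF, Olive.categorical_genericTheory,
    Olive.not_hasSOP_genericTheory hF, Olive.hasOlive_genericTheory hn0 hk1 hη hgap,
    Olive.omitsTheory _ (Olive.Forbidden k η), ?_, fun M _ _ => Olive.model_omitsTheory,
    Olive.isModelCompletion_genericTheory hF⟩
  rintro φ rfl
  exact Olive.isUniversal_omitsSentence
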